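/- Consider the discrete-time quantum walk on $\ell^2(\mathbb Z)\otimes\mathbb C^2$ with one-step operator $U_\Theta=S(\mathbb 1\otimes C_\Theta)$, where $S=\sum_x |x+1\rangle\langle x|\otimes|0\rangle\langle 0|+|x-1\rangle\langle x|\otimes|1\rangle\langle 1|$ and $$C_\Theta=\begin{pmatrix} e^{i\alpha}\cos\theta & e^{i\beta}\sin\theta\\ -e^{-i\beta}\sin\theta & e^{-i\alpha}\cos\theta\end{pmatrix},\qquad \Theta=(\theta,\alpha,\beta)\in\mathbb R^3 .$$ For a unit vector $\Psi(0)$ put $\Psi_\Theta(t)=U_\Theta^t\Psi(0)$, and let $$F_{\mu\nu}(t)=4\,\mathrm{Re}\big(\langle\partial_\mu\Psi|\partial_\nu\Psi\rangle-\langle\partial_\mu\Psi|\Psi\rangle\langle\Psi|\partial_\nu\Psi\rangle\big),\qquad \mu,\nu\in\{\theta,\alpha,\beta\},$$ be the quantum Fisher information (QFI) matrix of $\Psi=\Psi_\Theta(t)$. Let $u_k=\mathrm{diag}(e^{-ik},e^{ik})\,C_\Theta$ and $O_\mu=u_k^\dagger\,\partial_\mu u_k$. For a $2\times2$ matrix $O$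 let $|O))=(\mathrm{Tr}(O),\mathrm{Tr}(O\sigma_x),\mathrm{Tr}(O\sigma_y),\mathrm{Tr}(O\sigma_z))^T$, with $((O|$ its conjugate transpose. For $\sin\theta\neq0$ let $$A_k^{\mathbb 1}=N\begin{pmatrix}\frac1N&0\\0&m\,m^T\end{pmatrix},\quad m=\begin{pmatrix}\sin(k-\beta)\\-\cos(k-\beta)\\\cot\theta\,\sin(k-\alpha)\end{pmatrix},\quad N=\frac{\sin^2\theta}{1-\cos^2\theta\cos^2(k-\alpha)} .$$ Of the three coin parameters only $\theta$ and $\alpha$ can be estimated at the leading order $t^2$ of the QFI matrix for large $t$. Precisely: 1. If $\sin\theta\ne0$, then $A_k^{\mathbb 1}|O_\beta))=0$ for every $k\in\mathbb R$. 2. If $\sin\theta\ne0$, then for every initial state with momentum-space amplitude $\varphi_k(0)=\langle k|\Psi(0)\rangle$ (where $|k\rangle=\sum_x e^{ikx}|x\rangle$) and $\varrho_0=|\varphi_k(0)\rangle\langle\varphi_k(0)|$, and every $t\in\mathbb N$, all elements involving $\beta$ (that is, $\mu=\beta$ or $\nu=\beta$) of the large-time expression of the QFI matrix $$t^2\Big\{\int_{-\pi}^{\pi}\frac{dk}{2\pi}((O_\mu|A_k^{\mathbb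 1}|O_\nu))-\Big(\int_{-\pi}^{\pi}\frac{dk}{2\pi}((O_\mu|A_k^{\mathbb 1}|\varrho_0))\Big)\Big(\int_{-\pi}^{\pi}\frac{dk}{2\pi}((\varrho_0|A_k^{\mathbb 1}|O_\nu))\Big)\Big\}$$ vanish. 3. For every $\Theta$ and every initial state, $\Psi_\Theta(t)$ is differentiable in each parameter, and $\lim_{t\to\infty}F_{\mu\beta}(t)/t^2=\lim_{t\to\infty}F_{\beta\mu}(t)/t^2=0$ for every $\mu\in\{\theta,\alpha,\beta\}$. 4. There is an initial state such that, for all $\Theta$ with $\sin\theta\neq0$ and $\cos\theta\ne0$, the matrix $\frac1{t^2}\begin{pmatrix}F_{\theta\theta}&F_{\theta\alpha}\\F_{\alpha\theta}&F_{\alpha\alpha}\end{pmatrix}$ converges, as $t\to\infty$, to a positive definite matrix. -/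

import Mathlib

open scoped ENNReal

namespace QWalk

noncomputable section

/-- The three parameters of the coin operator. -/
inductive CoinParam
  | θ
  | α
  | β
  deriving DecidableEq

/-- A value `Θ = (θ, α, β)` of the coin parameters. -/
abbrev Params := CoinParam → ℝ

/-- The coin operator
`!![e^{iα} cos θ, e^{iβ} sin θ; -e^{-iβ} sin θ, e^{-iα} cos θ]`. -/
def coin (Θ : Params) : Matrix (Fin 2) (Fin 2) ℂ :=
  !![Complex.exp (Complex.I * (Θ .α : ℂ)) * (Real.cos (Θ .θ) : ℂ),
      Complex.exp (Complex.I * (Θ .β : ℂ)) * (Real.sin (Θ .θ) : ℂ);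
    -Complex.exp (-(Complex.I * (Θ .β : ℂ))) * (Real.sin (Θ .θ) : ℂ),
      Complex.exp (-(Complex.I * (Θ .α : ℂ))) * (Real.cos (Θ .θ) : ℂ)]

/-! The walk on position space. -/

/-- The Hilbert space `ℓ²(ℤ) ⊗ ℂ²` of lattice and coin, as `ℓ²(ℤ × {0, 1})`: the value of `ψ` at
`(x, j)` is the amplitude of `|x⟩ ⊗ |j⟩`. -/
abbrev WalkSpace : Type := lp (fun _ : ℤ × Fin 2 => ℂ) 2

/-- The amplitude of `|x⟩ ⊗ |j⟩` after a conditional shift is the amplitude before it at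
`shiftPerm (x, j)`, that is, at `(x - 1, 0)` if `j = 0` and at `(x + 1, 1)` if `j = 1`. -/
def shiftPerm : Equiv.Perm (ℤ × Fin 2) where
  toFun p := (if p.2 = 0 then p.1 - 1 else p.1 + 1, p.2)
  invFun p := (if p.2 = 0 then p.1 + 1 else p.1 - 1, p.2)
  left_inv p := by
    by_cases h : p.2 = 0 <;> ext <;> simp [h]
  right_inv p := by
    by_cases h : p.2 = 0 <;> ext <;> simp [h]

theorem memlp_iff (f : ℤ × Fin 2 → ℂ) :
    Memℓp f 2 ↔ Summable fun p => ‖f p‖ ^ 2 := by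
  rw [memℓp_gen_iff (by norm_num)]
  simp

theorem memlp_shift (ψ : WalkSpace) : Memℓp (fun p => ψ (shiftPerm p)) 2 := by
  have h := (memlp_iff (fun p => ψ p)).1 (lp.memℓp ψ)
  exact (memlp_iff _).2 (shiftPerm.summable_iff.2 h)

theorem memlp_comp_coin (ψ : WalkSpace) (l : Fin 2) :
    Memℓp (fun p : ℤ × Fin 2 => ψ (p.1, l)) 2 := by
  have h := (memlp_iff (fun p => ψ p)).1 (lp.memℓp ψ)
  have hl : Summable fun x : ℤ => ‖ψ (x, l)‖ ^ 2 :=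
    h.comp_injective (i := fun x : ℤ => (x, l)) (fun a b hab => congrArg Prod.fst hab)
  refine (memlp_iff _).2 ?_
  rw [← (Equiv.prodComm (Fin 2) ℤ).summable_iff]
  refine (summable_prod_of_nonneg (fun _ => sq_nonneg _)).2 ⟨fun _ => hl, ?_⟩
  exact (hasSum_fintype _).summable

theorem memlp_coin (C : Matrix (Fin 2) (Fin 2) ℂ) (ψ : WalkSpace) :
    Memℓp (fun p : ℤ × Fin 2 => ∑ l, C p.2 l * ψ (p.1, l)) 2 := by
  refine Memℓp.finsetSum (f := fun l (p : ℤ × Fin 2) => C p.2 l * ψ (p.1, l)) Finset.univ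
    fun l _ => ?_
  have h := (memlp_comp_coin ψ l).const_smul (‖C 0 l‖ + ‖C 1 l‖ : ℂ)
  refine h.mono' fun p => ?_
  obtain ⟨x, j⟩ := p
  have h0 : ‖(‖C 0 l‖ + ‖C 1 l‖ : ℂ)‖ = ‖C 0 l‖ + ‖C 1 l‖ := by
    rw [← Complex.ofReal_add, Complex.norm_real, Real.norm_of_nonneg (by positivity)]
  simp only [Pi.smul_apply, norm_smul, norm_mul, h0]
  refine mul_le_mul_of_nonneg_right ?_ (norm_nonneg _)
  fin_cases j
  · exact le_add_of_nonneg_right (norm_nonneg _)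
  · exact le_add_of_nonneg_left (norm_nonneg _)

/-- The conditional shift `S = ∑ₓ |x+1⟩⟨x| ⊗ |0⟩⟨0| + |x-1⟩⟨x| ⊗ |1⟩⟨1|`. -/
def shiftOp : WalkSpace →ₗ[ℂ] WalkSpace where
  toFun ψ := ⟨fun p => ψ (shiftPerm p), memlp_shift ψ⟩
  map_add' _ _ := rfl
  map_smul' _ _ := rfl

/-- The operator `𝟙 ⊗ C`. -/
def coinOp (C : Matrix (Fin 2) (Fin 2) ℂ) : WalkSpace →ₗ[ℂ] WalkSpace where
  toFun ψ := ⟨fun p => ∑ l, C p.2 l * ψ (p.1, l), memlp_coin C ψ⟩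
  map_add' ψ χ := by
    ext p
    change ∑ l, C p.2 l * (ψ (p.1, l) + χ (p.1, l)) =
      ∑ l, C p.2 l * ψ (p.1, l) + ∑ l, C p.2 l * χ (p.1, l)
    simp only [mul_add, Finset.sum_add_distrib]
  map_smul' c ψ := by
    ext p
    change ∑ l, C p.2 l * (c * ψ (p.1, l)) = c * ∑ l, C p.2 l * ψ (p.1, l)
    simp only [Finset.mul_sum, mul_left_comm]

/-- One step `U_Θ = S (𝟙 ⊗ C_Θ)` of the walk. -/
def stepOp (Θ : Params) : Module.End ℂ WalkSpace :=
  shiftOp ∘ₗ coinOp (coin Θ)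

/-- The state `|Ψ_Θ(t)⟩ = U_Θ ^ t |Ψ(0)⟩` after `t` steps. -/
def state (Ψ₀ : WalkSpace) (t : ℕ) (Θ : Params) : WalkSpace :=
  (stepOp Θ ^ t) Ψ₀

/-- The curve of states along which only the parameter `μ` varies. -/
def stateAlong (Ψ₀ : WalkSpace) (t : ℕ) (Θ : Params) (μ : CoinParam) (s : ℝ) : WalkSpace :=
  state Ψ₀ t (Function.update Θ μ s)

/-- The partial derivative `|∂_μ Ψ_Θ(t)⟩`, in the norm of the Hilbert space. -/
def dstate (Ψ₀ : WalkSpace) (t : ℕ) (Θ : Params) (μ : CoinParam) : WalkSpace :=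
  deriv (stateAlong Ψ₀ t Θ μ) (Θ μ)

/-- The element `F_{μν}` of the quantum Fisher information matrix of the pure-state model
`Θ ↦ |Ψ_Θ(t)⟩`:
`4 Re (⟨∂_μ Ψ|∂_ν Ψ⟩ - ⟨∂_μ Ψ|Ψ⟩ ⟨Ψ|∂_ν Ψ⟩)`. -/
def qfi (Ψ₀ : WalkSpace) (t : ℕ) (Θ : Params) (μ ν : CoinParam) : ℝ :=
  4 * (inner ℂ (dstate Ψ₀ t Θ μ) (dstate Ψ₀ t Θ ν)
    - inner ℂ (dstate Ψ₀ t Θ μ) (state Ψ₀ t Θ) * inner ℂ (state Ψ₀ t Θ) (dstate Ψ₀ t Θ ν)).re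

/-! The walk in momentum space. -/

/-- `u_k(Θ) = (e^{-ik} |0⟩⟨0| + e^{ik} |1⟩⟨1|) C_Θ`. -/
def stepK (k : ℝ) (Θ : Params) : Matrix (Fin 2) (Fin 2) ℂ :=
  !![Complex.exp (-(Complex.I * (k : ℂ))), 0; 0, Complex.exp (Complex.I * (k : ℂ))] * coin Θ

/-- `∂_μ u_k(Θ)`, entry by entry. -/
def dstepK (k : ℝ) (Θ : Params) (μ : CoinParam) : Matrix (Fin 2) (Fin 2) ℂ :=
  Matrix.of fun i j => deriv (fun s : ℝ => stepK k (Function.update Θ μ s) i j) (Θ μ)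

/-- `O_μ = u_k† ∂_μ u_k`. -/
def genO (k : ℝ) (Θ : Params) (μ : CoinParam) : Matrix (Fin 2) (Fin 2) ℂ :=
  (stepK k Θ).conjTranspose * dstepK k Θ μ

/-- The Pauli basis `𝟙, σ_x, σ_y, σ_z`. -/
def pauli : Fin 4 → Matrix (Fin 2) (Fin 2) ℂ :=
  ![1, !![0, 1; 1, 0], !![0, -Complex.I; Complex.I, 0], !![1, 0; 0, -1]]

/-- The four-component vector `|O))` of an operator `O` on the coin space, with components
`Tr (O σ_i)`. -/
def blochVec (O : Matrix (Fin 2) (Fin 2) ℂ) : Fin 4 → ℂ :=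
  fun i => (O * pauli i).trace

/-- `N = sin² θ / (1 - cos² θ cos² (k - α))`. -/
def normN (k : ℝ) (Θ : Params) : ℝ :=
  Real.sin (Θ .θ) ^ 2 / (1 - Real.cos (Θ .θ) ^ 2 * Real.cos (k - Θ .α) ^ 2)

/-- The matrix `A_k^𝟙` in real form. -/
def projAReal (k : ℝ) (Θ : Params) : Matrix (Fin 4) (Fin 4) ℝ :=
  normN k Θ •
    !![1 / normN k Θ, 0, 0, 0;
      0, Real.sin (k - Θ .β) ^ 2, -(Real.cos (k - Θ .β) * Real.sin (k - Θ .β)),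
        Real.cot (Θ .θ) * Real.sin (k - Θ .β) * Real.sin (k - Θ .α);
      0, -(Real.cos (k - Θ .β) * Real.sin (k - Θ .β)), Real.cos (k - Θ .β) ^ 2,
        -(Real.cot (Θ .θ) * Real.cos (k - Θ .β) * Real.sin (k - Θ .α));
      0, Real.cot (Θ .θ) * Real.sin (k - Θ .β) * Real.sin (k - Θ .α),
        -(Real.cot (Θ .θ) * Real.cos (k - Θ .β) * Real.sin (k - Θ .α)),
        Real.cot (Θ .θ) ^ 2 * Real.sin (k - Θ .α) ^ 2]

/-- The matrix `A_k^𝟙`, acting on four-component complex vectors. -/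
def projA (k : ℝ) (Θ : Params) : Matrix (Fin 4) (Fin 4) ℂ :=
  (projAReal k Θ).map Complex.ofReal

/-- `((v| A_k^𝟙 |w))`, where `((v|` is the conjugate transpose of `|v))`. -/
def sandwich (k : ℝ) (Θ : Params) (v w : Fin 4 → ℂ) : ℂ :=
  star v ⬝ᵥ (projA k Θ).mulVec w

/-- `φ k = ⟨k|Ψ₀⟩` is the momentum-space amplitude of `Ψ₀ ∈ ℓ²(ℤ) ⊗ ℂ²`: the square-integrable
function on `(-π, π]` with `Ψ₀ = (1 / 2π) ∫ |k⟩ ⊗ φ k dk`, where `|k⟩ = ∑ₓ e^{ikx} |x⟩`. -/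
def IsMomentumAmplitude (Ψ₀ : WalkSpace) (φ : ℝ → EuclideanSpace ℂ (Fin 2)) : Prop :=
  MeasureTheory.MemLp φ 2 (MeasureTheory.volume.restrict (Set.Ioc (-Real.pi) Real.pi)) ∧
    ∀ (x : ℤ) (j : Fin 2), Ψ₀ (x, j) =
      1 / (2 * (Real.pi : ℂ)) *
        ∫ k in (-Real.pi)..Real.pi, Complex.exp (Complex.I * (k : ℂ) * (x : ℂ)) * φ k j

/-- `ϱ₀ = |φ k⟩⟨φ k|`. -/
def rhoK (φ : ℝ → EuclideanSpace ℂ (Fin 2)) (k : ℝ) : Matrix (Fin 2) (Fin 2) ℂ :=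
  Matrix.of fun i j => φ k i * star (φ k j)

/-- The large-time (order `t²`) expression for the quantum Fisher information matrix:
`t² { ∫ dk/2π ((O_μ| A |O_ν)) - (∫ dk/2π ((O_μ| A |ϱ₀))) (∫ dk/2π ((ϱ₀| A |O_ν))) }`,
with `A = A_k^𝟙` and integrals over `[-π, π]`. -/
def qfiAsymp (φ : ℝ → EuclideanSpace ℂ (Fin 2)) (t : ℕ) (Θ : Params) (μ ν : CoinParam) : ℂ :=
  (t : ℂ) ^ 2 *
    ((1 / (2 * (Real.pi : ℂ)) * ∫ k in (-Real.pi)..Real.pi,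
        sandwich k Θ (blochVec (genO k Θ μ)) (blochVec (genO k Θ ν)))
      - (1 / (2 * (Real.pi : ℂ)) * ∫ k in (-Real.pi)..Real.pi,
          sandwich k Θ (blochVec (genO k Θ μ)) (blochVec (rhoK φ k)))
        * (1 / (2 * (Real.pi : ℂ)) * ∫ k in (-Real.pi)..Real.pi,
          sandwich k Θ (blochVec (rhoK φ k)) (blochVec (genO k Θ ν))))

end

end QWalk

open QWalk

/-! Write `U` for the step, `V` for its inverse and `K_μ = 𝟙 ⊗ C† ∂_μ C`. Then `∂_μ U^t = U^t
∑_{s<t} V^s K_μ U^s`, and since `U^t` is an isometry it drops out of the Fisher matrix. Thus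
`F_{μν}/t²` is a continuous form in the time averages of the conjugates of `K_μ` and `K_ν`, applied
to the initial state (`qfi_div_sq`). If `K = L + (V Y U - Y)` with `L` commuting with `U`, the sum
telescopes to `t L` plus a bounded term, so the average tends to `L` (`tendsto_conjSum`).

For `β` one has `L = 0`: the coin depends on `β` only through conjugation by `diag(e^{iβ/2},
e^{-iβ/2})`, which commutes with the shift. Hence `K_β` is the coboundary of `Z = (i/2) σ_z`
(`coinCLM_coinGen_beta`).

For the other parameters, `W = U + V` acts as a scalar on the coin and so commutes with every `K_μ`.
With `B = U - V`, `B² = W² - 4` is invertible when `sin θ ≠ 0`, and conjugation by `B` is an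
involution on `K_μ`. Its even part commutes with `U` and its odd part is a coboundary
(`exists_coboundary`), so the limit is `L_μ = (K_μ + B⁻¹ K_μ B)/2`. The limiting `θ`-`α` block is a
Gram matrix modulo the initial state. For a walker localized at one site, two amplitudes suffice to
show that it is nondegenerate.

The momentum-space statements are separate: the vector `m` is orthogonal to the Pauli components of
`O_β`, and `O_β` is traceless. -/

namespace QWalk

noncomputable section

/-! ### Sums of conjugates and coboundaries in a ring. -/

section Ring

variable {R : Type*} [Ring R]

/-- The sum `∑_{s < t} V ^ s K U ^ s`, where `V` is meant to be the inverse of `U`. -/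
def conjSum (U V K : R) (t : ℕ) : R :=
  ∑ s ∈ Finset.range t, V ^ s * K * U ^ s

theorem conjSum_succ (U V K : R) (t : ℕ) :
    conjSum U V K (t + 1) = conjSum U V K t + V ^ t * K * U ^ t :=
  Finset.sum_range_succ _ _

theorem pow_mul_pow_of_mul_eq_one {U V : R} (h : U * V = 1) (t : ℕ) : U ^ t * V ^ t = 1 := by
  induction t with
  | zero => simp
  | succ t ih =>
    rw [pow_succ, pow_succ']
    calc U ^ t * U * (V * V ^ t) = U ^ t * (U * V) * V ^ t := by noncomm_ring
      _ = 1 := by rw [h, mul_one, ih]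

/-- The conjugates of a coboundary telescope. -/
theorem conjSum_of_coboundary {U V K L Y : R} (hVU : V * U = 1) (hL : Commute L U)
    (hK : K = L + (V * Y * U - Y)) (t : ℕ) :
    conjSum U V K t = t • L + (V ^ t * Y * U ^ t - Y) := by
  induction t with
  | zero => simp [conjSum]
  | succ t ih =>
    have h : V ^ t * L * U ^ t = L := by
      rw [mul_assoc, (hL.pow_right t).eq, ← mul_assoc, pow_mul_pow_of_mul_eq_one hVU, one_mul]
    have h' : V ^ t * K * U ^ t = L + (V ^ (t + 1) * Y * U ^ (t + 1) - V ^ t * Y * U ^ t) := by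
      rw [hK, mul_add, add_mul, h, pow_succ V, pow_succ' U]
      noncomm_ring
    rw [conjSum_succ, ih, h', succ_nsmul]
    abel

/-- If `W = U + V` commutes with `K` and `B = U - V` is invertible, then `K` is, up to a
coboundary, the half sum of `K` and `B⁻¹ K B`, which commutes with `U`. -/
theorem exists_coboundary [Algebra ℂ R] {U V K B' : R} (hUV : U * V = 1) (hVU : V * U = 1)
    (hW : Commute (U + V) K) (hB : (U - V) * B' = 1) (hB' : B' * (U - V) = 1) :
    Commute ((1 / 2 : ℂ) • (K + B' * K * (U - V))) U ∧
    ∃ Y, K = (1 / 2 : ℂ) • (K + B' * K * (U - V)) + (V * Y * U - Y) := by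
  have cUV : Commute U V := hUV.trans hVU.symm
  set B := U - V with hBdef
  set W := U + V with hWdef
  have cWB : Commute W B :=
    ((Commute.refl U).sub_right cUV).add_left (cUV.symm.sub_right (Commute.refl V))
  have cUB : Commute U B := (Commute.refl U).sub_right cUV
  have inv_comm : ∀ {X : R}, Commute X B → Commute X B' := by
    intro X h
    change X * B' = B' * X
    calc X * B' = B' * B * X * B' := by rw [hB', one_mul]
      _ = B' * (X * B) * B' := by rw [h.eq]; noncomm_ring
      _ = B' * X * (B * B') := by noncomm_ring
      _ = B' * X := by rw [hB, mul_one]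
  -- This is where `UV = VU = 1` enters; it makes `B²` commute with `K`, because `W` does.
  have hBB : B * B = W * W - 4 := by
    rw [hBdef, hWdef]
    calc (U - V) * (U - V) = U * U + V * V - U * V - V * U := by noncomm_ring
      _ = U * U + V * V + U * V + V * U - (1 + 1 + 1 + 1) := by rw [hUV, hVU]; noncomm_ring
      _ = (U + V) * (U + V) - 4 := by
        rw [show (1 + 1 + 1 + 1 : R) = 4 by norm_num]; noncomm_ring
  have hBBK : B * B * K = K * (B * B) := by
    have h4 : Commute (4 : R) K := Nat.cast_commute 4 K
    rw [hBB]
    exact ((hW.mul_left hW).sub_left h4).eq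
  have hU : U = (1 / 2 : ℂ) • (W + B) := by
    have : W + B = (2 : ℂ) • U := by rw [two_smul]; simp [hBdef, hWdef]
    rw [this, smul_smul]; norm_num
  have hV : V = (1 / 2 : ℂ) • (W - B) := by
    have : W - B = (2 : ℂ) • V := by rw [two_smul]; simp [hBdef, hWdef]
    rw [this, smul_smul]; norm_num
  clear_value B W
  have cWC : Commute W (B' * K * B) := ((inv_comm cWB).mul_right hW).mul_right cWB
  have hC1 : B * (B' * K * B) = K * B := by
    rw [← mul_assoc, ← mul_assoc, hB, one_mul]
  have hC2 : B' * K * B * B = B * K := by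
    calc B' * K * B * B = B' * (K * (B * B)) := by noncomm_ring
      _ = (B' * B) * (B * K) := by rw [← hBBK]; noncomm_ring
      _ = B * K := by rw [hB', one_mul]
  have cB : Commute B (K + B' * K * B) := by
    change B * _ = _ * B
    rw [mul_add, add_mul, hC1, hC2, add_comm]
  have cW : Commute W (K + B' * K * B) := hW.add_right cWC
  refine ⟨?_, ?_⟩
  · refine (Commute.smul_left ?_ _)
    conv_rhs => rw [hU]
    exact (cW.symm.add_right cB.symm).smul_right _
  -- `A` is the odd part of `K` under conjugation by `B`: it commutes with `W` and anticommutes with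
  -- `B`, so passing it across exchanges `U = (W + B)/2` and `V = (W - B)/2`.
  · set A := (1 / 2 : ℂ) • (K - B' * K * B) with hA
    have aW : W * A = A * W := ((hW.sub_right cWC).smul_right _).eq
    have aB : B * A = -(A * B) := by
      rw [hA, mul_smul_comm, smul_mul_assoc, ← smul_neg, mul_sub, sub_mul, hC1, hC2, neg_sub]
    clear_value A
    have hVA : V * A = A * U := by
      rw [hV, hU, smul_mul_assoc, mul_smul_comm, sub_mul, mul_add, aB, aW, sub_neg_eq_add]
    have cU' : Commute U B' := inv_comm cUB
    -- With `Y = A B⁻¹ V`, the relation `V A = A U` gives `V Y U = A U B⁻¹`, so `V Y U - Y = A (U -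
    -- V) B⁻¹ = A`.
    refine ⟨A * (B' * V), ?_⟩
    have h1 : V * (A * (B' * V)) * U = A * (U * B') := by
      calc V * (A * (B' * V)) * U = (V * A) * B' * (V * U) := by noncomm_ring
        _ = A * (U * B') := by rw [hVA, hVU]; noncomm_ring
    have h2 : A * (U * B') - A * (B' * V) = A := by
      rw [← mul_sub, cU'.eq, ← mul_sub, ← hBdef, hB', mul_one]
    rw [h1, h2, hA, ← smul_add, add_add_sub_cancel, ← two_smul ℂ K, smul_smul]
    norm_num

/-- Leibniz rule for `U · U^t`. The new term `U K U^t` becomes `U^{t+1} (V^t K U^t)` by inserting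
`U^t V^t = 1`, so that `U^{t+1}` can be factored out on the left. -/
theorem hasDerivAt_pow_conjSum {A : Type*} [NormedRing A] [NormedAlgebra ℝ A] {U : ℝ → A} {s : ℝ}
    {V K : A} (hU : HasDerivAt U (U s * K) s) (h : U s * V = 1) (t : ℕ) :
    HasDerivAt (fun x => U x ^ t) (U s ^ t * conjSum (U s) V K t) s := by
  induction t with
  | zero => simpa [conjSum] using hasDerivAt_const s (1 : A)
  | succ t ih =>
    have h1 := hU.mul ih
    have h2 : U s * K * U s ^ t + U s * (U s ^ t * conjSum (U s) V K t) =
        U s ^ (t + 1) * conjSum (U s) V K (t + 1) := by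
      have : U s ^ (t + 1) * (V ^ t * K * U s ^ t) = U s * K * U s ^ t := by
        calc U s ^ (t + 1) * (V ^ t * K * U s ^ t)
            = U s * (U s ^ t * V ^ t) * K * U s ^ t := by rw [pow_succ']; noncomm_ring
          _ = _ := by rw [pow_mul_pow_of_mul_eq_one h, mul_one]
      rw [conjSum_succ, mul_add, this, pow_succ', mul_assoc (U s) (U s ^ t), add_comm]
    rw [h2] at h1
    refine h1.congr_of_eventuallyEq (Filter.Eventually.of_forall fun x => ?_)
    simp [pow_succ']

end Ring

/-! ### Time averages and the Fisher form on a Hilbert space. -/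

section Hilbert

variable {H : Type*} [NormedAddCommGroup H] [InnerProductSpace ℂ H]

theorem norm_pow_apply {U : H →L[ℂ] H} (hU : ∀ x, ‖U x‖ = ‖x‖) (t : ℕ) (x : H) :
    ‖(U ^ t) x‖ = ‖x‖ := by
  induction t with
  | zero => simp
  | succ t ih => rw [pow_succ', mul_apply_eq_comp, hU, ih]

theorem norm_conjugate_le {U V : H →L[ℂ] H} (hU : ∀ x, ‖U x‖ = ‖x‖) (hV : ∀ x, ‖V x‖ = ‖x‖)
    (K : H →L[ℂ] H) (t : ℕ) (x : H) : ‖(V ^ t * K * U ^ t) x‖ ≤ ‖K‖ * ‖x‖ := by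
  rw [mul_apply_eq_comp, mul_apply_eq_comp, norm_pow_apply hV]
  exact (K.le_opNorm _).trans_eq (by rw [norm_pow_apply hU])

theorem norm_conjSum_le {U V : H →L[ℂ] H} (hU : ∀ x, ‖U x‖ = ‖x‖) (hV : ∀ x, ‖V x‖ = ‖x‖)
    (K : H →L[ℂ] H) (t : ℕ) (x : H) : ‖conjSum U V K t x‖ ≤ t * (‖K‖ * ‖x‖) := by
  rw [conjSum, sum_apply]
  refine (norm_sum_le_of_le _ fun s _ => norm_conjugate_le hU hV K s x).trans_eq ?_
  simp

/-- The averages of the conjugates of an operator that differs from an operator commuting with `U`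
by a coboundary. -/
theorem tendsto_conjSum {U V K L Y : H →L[ℂ] H} (hU : ∀ x, ‖U x‖ = ‖x‖) (hV : ∀ x, ‖V x‖ = ‖x‖)
    (hVU : V * U = 1) (hL : Commute L U) (hK : K = L + (V * Y * U - Y)) (x : H) :
    Filter.Tendsto (fun t : ℕ => ((t : ℂ)⁻¹) • conjSum U V K t x) Filter.atTop (nhds (L x)) := by
  rw [tendsto_iff_norm_sub_tendsto_zero]
  have h0 : Filter.Tendsto (fun t : ℕ => (2 * (‖Y‖ * ‖x‖)) * ((t : ℝ)⁻¹)) Filter.atTop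
      (nhds 0) := by
    simpa using tendsto_inv_atTop_nhds_zero_nat.const_mul (2 * (‖Y‖ * ‖x‖))
  refine squeeze_zero' (Filter.Eventually.of_forall fun _ => norm_nonneg _) ?_ h0
  filter_upwards [Filter.eventually_gt_atTop 0] with t ht
  have htc : (t : ℂ) ≠ 0 := by exact_mod_cast ht.ne'
  -- After telescoping, the error is `t⁻¹` times a vector of norm at most `2 ‖Y‖ ‖x‖`.
  have h1 : ((t : ℂ)⁻¹) • conjSum U V K t x - L x
      = ((t : ℂ)⁻¹) • ((V ^ t * Y * U ^ t) x - Y x) := by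
    rw [conjSum_of_coboundary hVU hL hK, add_apply,
      sub_apply, ← Nat.cast_smul_eq_nsmul ℂ, smul_apply,
      smul_add, smul_smul, inv_mul_cancel₀ htc, one_smul, add_sub_cancel_left]
  rw [h1, norm_smul, norm_inv, Complex.norm_natCast, mul_comm]
  refine mul_le_mul_of_nonneg_right ?_ (by positivity)
  refine (norm_sub_le _ _).trans ?_
  have h2 := norm_conjugate_le hU hV Y t x
  have h3 := Y.le_opNorm x
  linarith

/-- The real inner product, up to the factor 4, of the components of `v` and `w` orthogonal to a
unit vector `ψ`. -/
def fisherForm (ψ v w : H) : ℝ :=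
  4 * (inner ℂ v w - inner ℂ v ψ * inner ℂ ψ w).re

theorem fisherForm_smul (ψ v w : H) (r : ℝ) :
    fisherForm ψ ((r : ℂ) • v) ((r : ℂ) • w) = r ^ 2 * fisherForm ψ v w := by
  have : inner ℂ ((r : ℂ) • v) ((r : ℂ) • w) - inner ℂ ((r : ℂ) • v) ψ * inner ℂ ψ ((r : ℂ) • w)
      = ((r ^ 2 : ℝ) : ℂ) * (inner ℂ v w - inner ℂ v ψ * inner ℂ ψ w) := by
    simp only [inner_smul_left, inner_smul_right, Complex.conj_ofReal]
    push_cast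
    ring
  rw [fisherForm, this, Complex.re_ofReal_mul, fisherForm]
  ring

theorem fisherForm_comm (ψ v w : H) : fisherForm ψ v w = fisherForm ψ w v := by
  have : inner ℂ w v - inner ℂ w ψ * inner ℂ ψ v
      = (starRingEnd ℂ) (inner ℂ v w - inner ℂ v ψ * inner ℂ ψ w) := by
    simp only [map_sub, map_mul, inner_conj_symm]
    ring
  rw [fisherForm, fisherForm, this, Complex.conj_re]

theorem fisherForm_map {U : H →L[ℂ] H} (hU : ∀ x, ‖U x‖ = ‖x‖) (ψ v w : H) :
    fisherForm (U ψ) (U v) (U w) = fisherForm ψ v w := by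
  have h := (LinearMap.norm_map_iff_inner_map_map U).1 hU
  simp only [fisherForm, h]

/-- Cauchy–Schwarz on both terms gives `8 = 4 · 2`. The bound makes mixed entries vanish in the
limit when one argument stays bounded and the other tends to zero. -/
theorem abs_fisherForm_le {ψ : H} (hψ : ‖ψ‖ = 1) (v w : H) :
    |fisherForm ψ v w| ≤ 8 * (‖v‖ * ‖w‖) := by
  rw [fisherForm, abs_mul, abs_of_nonneg (by norm_num : (0 : ℝ) ≤ 4)]
  have h1 : ‖inner ℂ v w‖ ≤ ‖v‖ * ‖w‖ := norm_inner_le_norm _ _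
  have h2 : ‖inner ℂ v ψ * inner ℂ ψ w‖ ≤ ‖v‖ * ‖w‖ := by
    rw [norm_mul]
    refine mul_le_mul ?_ ?_ (norm_nonneg _) (norm_nonneg _)
    · simpa [hψ] using norm_inner_le_norm (𝕜 := ℂ) v ψ
    · simpa [hψ] using norm_inner_le_norm (𝕜 := ℂ) ψ w
  have h3 := (Complex.abs_re_le_norm _).trans (norm_sub_le (inner ℂ v w) (inner ℂ v ψ * inner ℂ ψ w))
  linarith

theorem continuous_fisherForm (ψ : H) : Continuous fun p : H × H => fisherForm ψ p.1 p.2 := by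
  unfold fisherForm
  fun_prop

theorem fisherForm_combination (ψ v w : H) (a b : ℝ) :
    fisherForm ψ ((a : ℂ) • v + (b : ℂ) • w) ((a : ℂ) • v + (b : ℂ) • w) =
      a * (fisherForm ψ v v * a + fisherForm ψ v w * b) +
        b * (fisherForm ψ w v * a + fisherForm ψ w w * b) := by
  simp only [fisherForm, inner_add_left, inner_add_right, inner_smul_left, inner_smul_right,
    Complex.conj_ofReal, Complex.add_re, Complex.sub_re, Complex.mul_re, Complex.mul_im,
    Complex.add_im, Complex.ofReal_re, Complex.ofReal_im]
  ring

/-- The form only sees the component orthogonal to `ψ`, so it degenerates exactly on the multiples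
of `ψ`. -/
theorem fisherForm_self {ψ : H} (hψ : ‖ψ‖ = 1) (v : H) :
    fisherForm ψ v v = 4 * ‖v - (inner ℂ ψ v) • ψ‖ ^ 2 := by
  have h : inner ℂ (v - (inner ℂ ψ v) • ψ) (v - (inner ℂ ψ v) • ψ)
      = inner ℂ v v - inner ℂ v ψ * inner ℂ ψ v := by
    simp only [inner_sub_left, inner_sub_right, inner_smul_left, inner_smul_right,
      inner_self_eq_norm_sq_to_K (𝕜 := ℂ) ψ, hψ, inner_conj_symm]
    simp
  rw [fisherForm, ← h, inner_self_eq_norm_sq_to_K]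
  norm_cast

/-- The Gram matrix of two vectors that are independent, over the reals, modulo the unit vector
`ψ`. -/
theorem posDef_fisherForm {ψ v w : H} (hψ : ‖ψ‖ = 1)
    (h : ∀ (a b : ℝ) (c : ℂ), (a : ℂ) • v + (b : ℂ) • w = c • ψ → a = 0 ∧ b = 0) :
    (!![fisherForm ψ v v, fisherForm ψ v w; fisherForm ψ w v, fisherForm ψ w w]).PosDef := by
  refine Matrix.PosDef.of_dotProduct_mulVec_pos ?_ fun x hx => ?_
  · ext i j
    fin_cases i <;> fin_cases j <;> simp [fisherForm_comm ψ w v]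
  · have h1 := fisherForm_combination ψ v w (x 0) (x 1)
    have h2 : star x ⬝ᵥ Matrix.mulVec
        !![fisherForm ψ v v, fisherForm ψ v w; fisherForm ψ w v, fisherForm ψ w w] x =
        fisherForm ψ ((x 0 : ℂ) • v + (x 1 : ℂ) • w) ((x 0 : ℂ) • v + (x 1 : ℂ) • w) := by
      rw [h1]
      simp [dotProduct, Matrix.mulVec, Fin.sum_univ_two]
    rw [h2, fisherForm_self hψ]
    refine mul_pos (by norm_num) (pow_pos (norm_pos_iff.2 fun h0 => hx ?_) 2)
    obtain ⟨ha, hb⟩ := h _ _ _ (sub_eq_zero.1 h0)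
    ext i
    fin_cases i
    · exact ha
    · exact hb

end Hilbert

/-! Continuity and unitarity of the building blocks of the walk. -/

theorem inner_walk_eq_tsum (ψ χ : WalkSpace) :
    inner ℂ ψ χ = ∑' p, inner ℂ (ψ p) (χ p) :=
  lp.inner_eq_tsum ψ χ

theorem memlp_comp_perm (e : Equiv.Perm (ℤ × Fin 2)) (ψ : WalkSpace) :
    Memℓp (fun p => ψ (e p)) 2 :=
  (memlp_iff _).2 (e.summable_iff.2 ((memlp_iff (fun p => ψ p)).1 (lp.memℓp ψ)))

/-- Composition with a permutation of the basis, as an isometry. -/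
def permIsometry (e : Equiv.Perm (ℤ × Fin 2)) : WalkSpace →ₗᵢ[ℂ] WalkSpace :=
  LinearMap.isometryOfInner
    { toFun := fun ψ => ⟨fun p => ψ (e p), memlp_comp_perm e ψ⟩
      map_add' := fun _ _ => rfl
      map_smul' := fun _ _ => rfl } fun ψ χ => by
    rw [inner_walk_eq_tsum, inner_walk_eq_tsum]
    exact e.tsum_eq fun p => inner ℂ (ψ p) (χ p)

/-- Composition with a permutation of the basis. -/
def permCLM (e : Equiv.Perm (ℤ × Fin 2)) : WalkSpace →L[ℂ] WalkSpace :=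
  (permIsometry e).toContinuousLinearMap

theorem permCLM_apply (e : Equiv.Perm (ℤ × Fin 2)) (ψ : WalkSpace) (p : ℤ × Fin 2) :
    permCLM e ψ p = ψ (e p) := rfl

theorem norm_permCLM_apply (e : Equiv.Perm (ℤ × Fin 2)) (ψ : WalkSpace) :
    ‖permCLM e ψ‖ = ‖ψ‖ := (permIsometry e).norm_map ψ

/-- By the closed graph theorem: coordinates are continuous, and each output coordinate is a finite
combination of input coordinates. -/
theorem continuous_coinOp (C : Matrix (Fin 2) (Fin 2) ℂ) : Continuous (coinOp C) := by
  refine LinearMap.continuous_of_seq_closed_graph _ fun u ψ χ hu hχ => ?_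
  ext p
  have ev : ∀ p : ℤ × Fin 2, Continuous fun ψ : WalkSpace => ψ p := fun p =>
    (lp.evalCLM ℂ (fun _ : ℤ × Fin 2 => ℂ) 2 p).continuous
  have h1 := ((ev p).tendsto χ).comp hχ
  have h2 : Filter.Tendsto (fun n => ∑ l, C p.2 l * u n (p.1, l)) Filter.atTop
      (nhds (∑ l, C p.2 l * ψ (p.1, l))) :=
    tendsto_finsetSum _ fun l _ => (((ev (p.1, l)).tendsto ψ).comp hu).const_mul _
  exact tendsto_nhds_unique h1 h2

/-- The operator `𝟙 ⊗ C`, as a continuous linear map. -/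
def coinCLM (C : Matrix (Fin 2) (Fin 2) ℂ) : WalkSpace →L[ℂ] WalkSpace :=
  ⟨coinOp C, continuous_coinOp C⟩

theorem coinCLM_apply (C : Matrix (Fin 2) (Fin 2) ℂ) (ψ : WalkSpace) (x : ℤ) (j : Fin 2) :
    coinCLM C ψ (x, j) = C j 0 * ψ (x, 0) + C j 1 * ψ (x, 1) :=
  Fin.sum_univ_two fun l => C j l * ψ (x, l)

theorem walk_ext {ψ χ : WalkSpace} (h0 : ∀ x, ψ (x, 0) = χ (x, 0))
    (h1 : ∀ x, ψ (x, 1) = χ (x, 1)) : ψ = χ := by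
  ext ⟨x, j⟩
  fin_cases j
  · exact h0 x
  · exact h1 x

theorem coinCLM_mul (C D : Matrix (Fin 2) (Fin 2) ℂ) :
    coinCLM (C * D) = coinCLM C * coinCLM D := by
  ext1 ψ
  rw [mul_apply_eq_comp]
  refine walk_ext (fun x => ?_) fun x => ?_ <;>
  · simp only [coinCLM_apply, Matrix.mul_apply, Fin.sum_univ_two]
    ring

theorem coinCLM_one : coinCLM 1 = 1 := by
  ext1 ψ
  refine walk_ext (fun x => ?_) fun x => ?_ <;> simp [coinCLM_apply]

theorem coinCLM_add (C D : Matrix (Fin 2) (Fin 2) ℂ) :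
    coinCLM (C + D) = coinCLM C + coinCLM D := by
  ext1 ψ
  rw [add_apply]
  refine walk_ext (fun x => ?_) fun x => ?_ <;>
  · rw [lp.coeFn_add, Pi.add_apply]
    simp only [coinCLM_apply, Matrix.add_apply]
    ring

theorem coinCLM_smul (c : ℂ) (C : Matrix (Fin 2) (Fin 2) ℂ) :
    coinCLM (c • C) = c • coinCLM C := by
  ext1 ψ
  rw [smul_apply]
  refine walk_ext (fun x => ?_) fun x => ?_ <;>
  · rw [lp.coeFn_smul, Pi.smul_apply]
    simp only [coinCLM_apply, Matrix.smul_apply, smul_eq_mul]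
    ring

/-- Expansion in matrix units, which turns entrywise differentiability of the coin into
differentiability in operator norm. -/
theorem coinCLM_eq_sum (C : Matrix (Fin 2) (Fin 2) ℂ) :
    coinCLM C = C 0 0 • coinCLM !![1, 0; 0, 0] + C 0 1 • coinCLM !![0, 1; 0, 0] +
      C 1 0 • coinCLM !![0, 0; 1, 0] + C 1 1 • coinCLM !![0, 0; 0, 1] := by
  rw [← coinCLM_smul, ← coinCLM_smul, ← coinCLM_smul, ← coinCLM_smul, ← coinCLM_add,
    ← coinCLM_add, ← coinCLM_add]
  congr 1
  ext i j
  fin_cases i <;> fin_cases j <;> simp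

theorem inner_coinCLM (C : Matrix (Fin 2) (Fin 2) ℂ) (ψ χ : WalkSpace) :
    inner ℂ (coinCLM C ψ) χ = inner ℂ ψ (coinCLM C.conjTranspose χ) := by
  have key : ∀ ψ χ : WalkSpace, inner ℂ ψ χ =
      ∑' x : ℤ, (inner ℂ (ψ (x, 0)) (χ (x, 0)) + inner ℂ (ψ (x, 1)) (χ (x, 1))) := by
    intro ψ χ
    have hs : Summable fun p : ℤ × Fin 2 => (inner ℂ (ψ p) (χ p) : ℂ) :=
      (lp.hasSum_inner ψ χ).summable
    rw [inner_walk_eq_tsum, hs.tsum_prod]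
    simp only [tsum_fintype, Fin.sum_univ_two]
  rw [key, key]
  refine tsum_congr fun x => ?_
  rw [coinCLM_apply, coinCLM_apply, coinCLM_apply, coinCLM_apply]
  simp only [RCLike.inner_apply, map_add, map_mul, Matrix.conjTranspose_apply, RCLike.star_def]
  ring

theorem norm_coinCLM_apply {C : Matrix (Fin 2) (Fin 2) ℂ} (hC : C.conjTranspose * C = 1)
    (ψ : WalkSpace) : ‖coinCLM C ψ‖ = ‖ψ‖ := by
  have h : inner ℂ (coinCLM C ψ) (coinCLM C ψ) = inner ℂ ψ ψ := by
    rw [inner_coinCLM, ← mul_apply_eq_comp, ← coinCLM_mul, hC, coinCLM_one]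
    rfl
  rw [inner_self_eq_norm_sq_to_K, inner_self_eq_norm_sq_to_K] at h
  have h' : ‖coinCLM C ψ‖ ^ 2 = ‖ψ‖ ^ 2 := by exact_mod_cast h
  exact (pow_left_inj₀ (norm_nonneg _) (norm_nonneg _) two_ne_zero).1 h'

theorem hasDerivAt_coinCLM {C : ℝ → Matrix (Fin 2) (Fin 2) ℂ} {D : Matrix (Fin 2) (Fin 2) ℂ}
    {s : ℝ} (h : ∀ i j, HasDerivAt (fun x => C x i j) (D i j) s) :
    HasDerivAt (fun x => coinCLM (C x)) (coinCLM D) s := by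
  rw [coinCLM_eq_sum D, funext fun x => coinCLM_eq_sum (C x)]
  have hE : ∀ i j (E : WalkSpace →L[ℂ] WalkSpace),
      HasDerivAt (fun x => C x i j • E) (D i j • E) s := fun i j E =>
    ((ContinuousLinearMap.toSpanSingleton ℂ E).restrictScalars ℝ).hasFDerivAt.comp_hasDerivAt s
      (h i j)
  exact (((hE _ _ _).fun_add (hE _ _ _)).fun_add (hE _ _ _)).fun_add (hE _ _ _)

/-! The coin and its derivatives. -/

theorem exp_mul_exp_neg (x : ℂ) : Complex.exp x * Complex.exp (-x) = 1 := by
  rw [← Complex.exp_add, add_neg_cancel, Complex.exp_zero]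

theorem ofReal_sin_sq_add_cos_sq (x : ℝ) : ((Real.sin x : ℝ) : ℂ) ^ 2 + (Real.cos x : ℂ) ^ 2 = 1 := by
  exact_mod_cast Real.sin_sq_add_cos_sq x

theorem star_exp_I_mul (x : ℝ) :
    star (Complex.exp (Complex.I * (x : ℂ))) = Complex.exp (-(Complex.I * (x : ℂ))) := by
  rw [Complex.star_def, ← Complex.exp_conj]
  simp

theorem star_exp_neg_I_mul (x : ℝ) :
    star (Complex.exp (-(Complex.I * (x : ℂ)))) = Complex.exp (Complex.I * (x : ℂ)) := by
  rw [← star_exp_I_mul, star_star]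

theorem star_ofReal (x : ℝ) : star (x : ℂ) = (x : ℂ) := Complex.conj_ofReal x

theorem conjTranspose_coin (Θ : Params) : (coin Θ).conjTranspose =
    !![Complex.exp (-(Complex.I * (Θ .α : ℂ))) * (Real.cos (Θ .θ) : ℂ),
      -Complex.exp (Complex.I * (Θ .β : ℂ)) * (Real.sin (Θ .θ) : ℂ);
    Complex.exp (-(Complex.I * (Θ .β : ℂ))) * (Real.sin (Θ .θ) : ℂ),
      Complex.exp (Complex.I * (Θ .α : ℂ)) * (Real.cos (Θ .θ) : ℂ)] := by
  ext i j
  fin_cases i <;> fin_cases j <;>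
    simp [coin, Matrix.conjTranspose_apply, -Complex.ofReal_cos, -Complex.ofReal_sin,
      -Complex.star_def, star_exp_I_mul, star_exp_neg_I_mul, star_ofReal]

theorem conjTranspose_coin_mul_coin (Θ : Params) : (coin Θ).conjTranspose * coin Θ = 1 := by
  rw [conjTranspose_coin, coin]
  have ha := exp_mul_exp_neg (Complex.I * (Θ .α : ℂ))
  have hb := exp_mul_exp_neg (Complex.I * (Θ .β : ℂ))
  have hs := ofReal_sin_sq_add_cos_sq (Θ .θ)
  generalize Complex.exp (Complex.I * (Θ .α : ℂ)) = a at *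
  generalize Complex.exp (-(Complex.I * (Θ .α : ℂ))) = a' at *
  generalize Complex.exp (Complex.I * (Θ .β : ℂ)) = b at *
  generalize Complex.exp (-(Complex.I * (Θ .β : ℂ))) = b' at *
  generalize ((Real.sin (Θ .θ) : ℝ) : ℂ) = s at *
  generalize ((Real.cos (Θ .θ) : ℝ) : ℂ) = c at *
  ext i j
  fin_cases i <;> fin_cases j <;> simp [Matrix.mul_apply, Fin.sum_univ_two]
  · linear_combination hs + c ^ 2 * ha + s ^ 2 * hb
  · ring
  · ring
  · linear_combination hs + c ^ 2 * ha + s ^ 2 * hb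

theorem coin_mul_conjTranspose_coin (Θ : Params) : coin Θ * (coin Θ).conjTranspose = 1 :=
  mul_eq_one_comm.1 (conjTranspose_coin_mul_coin Θ)

/-- The generator `C† ∂_μ C`. -/
def coinGen (Θ : Params) : CoinParam → Matrix (Fin 2) (Fin 2) ℂ
  | .θ => !![0, Complex.exp (-(Complex.I * (Θ .α : ℂ))) * Complex.exp (Complex.I * (Θ .β : ℂ));
      -(Complex.exp (Complex.I * (Θ .α : ℂ)) * Complex.exp (-(Complex.I * (Θ .β : ℂ)))), 0]
  | .α => Complex.I • !![(Real.cos (Θ .θ) : ℂ) ^ 2,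
      Complex.exp (-(Complex.I * (Θ .α : ℂ))) * Complex.exp (Complex.I * (Θ .β : ℂ)) *
        ((Real.sin (Θ .θ) : ℂ) * (Real.cos (Θ .θ) : ℂ));
      Complex.exp (Complex.I * (Θ .α : ℂ)) * Complex.exp (-(Complex.I * (Θ .β : ℂ))) *
        ((Real.sin (Θ .θ) : ℂ) * (Real.cos (Θ .θ) : ℂ)), -(Real.cos (Θ .θ) : ℂ) ^ 2]
  | .β => Complex.I • !![-(Real.sin (Θ .θ) : ℂ) ^ 2,
      Complex.exp (-(Complex.I * (Θ .α : ℂ))) * Complex.exp (Complex.I * (Θ .β : ℂ)) *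
        ((Real.sin (Θ .θ) : ℂ) * (Real.cos (Θ .θ) : ℂ));
      Complex.exp (Complex.I * (Θ .α : ℂ)) * Complex.exp (-(Complex.I * (Θ .β : ℂ))) *
        ((Real.sin (Θ .θ) : ℂ) * (Real.cos (Θ .θ) : ℂ)), (Real.sin (Θ .θ) : ℂ) ^ 2]

/-- The entrywise derivative of the coin. -/
def coinDeriv (Θ : Params) : CoinParam → Matrix (Fin 2) (Fin 2) ℂ
  | .θ => !![-(Complex.exp (Complex.I * (Θ .α : ℂ)) * (Real.sin (Θ .θ) : ℂ)),
      Complex.exp (Complex.I * (Θ .β : ℂ)) * (Real.cos (Θ .θ) : ℂ);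
      -Complex.exp (-(Complex.I * (Θ .β : ℂ))) * (Real.cos (Θ .θ) : ℂ),
      -(Complex.exp (-(Complex.I * (Θ .α : ℂ))) * (Real.sin (Θ .θ) : ℂ))]
  | .α => Complex.I • !![Complex.exp (Complex.I * (Θ .α : ℂ)) * (Real.cos (Θ .θ) : ℂ), 0;
      0, -(Complex.exp (-(Complex.I * (Θ .α : ℂ))) * (Real.cos (Θ .θ) : ℂ))]
  | .β => Complex.I • !![0, Complex.exp (Complex.I * (Θ .β : ℂ)) * (Real.sin (Θ .θ) : ℂ);
      Complex.exp (-(Complex.I * (Θ .β : ℂ))) * (Real.sin (Θ .θ) : ℂ), 0]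

theorem coin_mul_coinGen (Θ : Params) (μ : CoinParam) :
    coin Θ * coinGen Θ μ = coinDeriv Θ μ := by
  have ha := exp_mul_exp_neg (Complex.I * (Θ .α : ℂ))
  have hb := exp_mul_exp_neg (Complex.I * (Θ .β : ℂ))
  have hs := ofReal_sin_sq_add_cos_sq (Θ .θ)
  cases μ <;> simp only [coin, coinGen, coinDeriv] <;>
  generalize Complex.exp (Complex.I * (Θ .α : ℂ)) = a at * <;>
  generalize Complex.exp (-(Complex.I * (Θ .α : ℂ))) = a' at * <;>
  generalize Complex.exp (Complex.I * (Θ .β : ℂ)) = b at * <;>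
  generalize Complex.exp (-(Complex.I * (Θ .β : ℂ))) = b' at * <;>
  generalize ((Real.sin (Θ .θ) : ℝ) : ℂ) = s at * <;>
  generalize ((Real.cos (Θ .θ) : ℝ) : ℂ) = c at * <;>
  ext i j <;>
  fin_cases i <;> fin_cases j <;> simp [Matrix.mul_apply, Fin.sum_univ_two]
  · linear_combination (a * s) * hb
  · linear_combination (c * b) * ha
  · linear_combination (c * b') * ha
  · linear_combination (a' * s) * hb
  · linear_combination Complex.I * (a * c) * (hs + s ^ 2 * hb)
  · linear_combination Complex.I * (b * c ^ 2 * s) * ha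
  · linear_combination Complex.I * (b' * c ^ 2 * s) * ha
  · linear_combination -Complex.I * (a' * c) * (hs + s ^ 2 * hb)
  · linear_combination Complex.I * (a * c * s ^ 2) * hb
  · linear_combination Complex.I * (b * s) * (hs + c ^ 2 * ha)
  · linear_combination Complex.I * (b' * s) * (hs + c ^ 2 * ha)
  · linear_combination -Complex.I * (a' * c * s ^ 2) * hb

theorem hasDerivAt_exp_I_mul (x : ℝ) :
    HasDerivAt (fun s : ℝ => Complex.exp (Complex.I * (s : ℂ)))
      (Complex.I * Complex.exp (Complex.I * (x : ℂ))) x := by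
  have h := ((hasDerivAt_id x).ofReal_comp.const_mul Complex.I).cexp
  simpa [mul_comm] using h

theorem hasDerivAt_exp_neg_I_mul (x : ℝ) :
    HasDerivAt (fun s : ℝ => Complex.exp (-(Complex.I * (s : ℂ))))
      (-Complex.I * Complex.exp (-(Complex.I * (x : ℂ)))) x := by
  have h := ((hasDerivAt_id x).ofReal_comp.const_mul Complex.I).neg.cexp
  simpa [mul_comm] using h

theorem hasDerivAt_coin (Θ : Params) (μ : CoinParam) (i j : Fin 2) :
    HasDerivAt (fun s : ℝ => coin (Function.update Θ μ s) i j) (coinDeriv Θ μ i j) (Θ μ) := by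
  have hc := (Real.hasDerivAt_cos (Θ .θ)).ofReal_comp
  have hs := (Real.hasDerivAt_sin (Θ .θ)).ofReal_comp
  have h1 := hasDerivAt_exp_I_mul (Θ μ)
  have h2 := hasDerivAt_exp_neg_I_mul (Θ μ)
  cases μ <;> fin_cases i <;> fin_cases j <;>
    simp [coin, coinDeriv, -Complex.ofReal_cos, -Complex.ofReal_sin]
  · simpa using hc.const_mul (Complex.exp (Complex.I * (Θ .α : ℂ)))
  · simpa using hs.const_mul (Complex.exp (Complex.I * (Θ .β : ℂ)))
  · simpa using (hs.const_mul (Complex.exp (-(Complex.I * (Θ .β : ℂ))))).fun_neg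
  · simpa using hc.const_mul (Complex.exp (-(Complex.I * (Θ .α : ℂ))))
  · simpa [mul_assoc] using h1.mul_const (Real.cos (Θ .θ) : ℂ)
  · exact hasDerivAt_const _ _
  · exact hasDerivAt_const _ _
  · simpa [mul_assoc] using h2.mul_const (Real.cos (Θ .θ) : ℂ)
  · exact hasDerivAt_const _ _
  · simpa [mul_assoc] using h1.mul_const (Real.sin (Θ .θ) : ℂ)
  · simpa [mul_assoc] using (h2.mul_const (Real.sin (Θ .θ) : ℂ)).fun_neg
  · exact hasDerivAt_const _ _

/-! The step operator. -/

/-- The step operator, as a continuous linear map. -/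
def stepCLM (Θ : Params) : WalkSpace →L[ℂ] WalkSpace :=
  permCLM shiftPerm * coinCLM (coin Θ)

/-- The inverse of the step operator. -/
def stepInv (Θ : Params) : WalkSpace →L[ℂ] WalkSpace :=
  coinCLM (coin Θ).conjTranspose * permCLM shiftPerm.symm

theorem permCLM_mul_symm (e : Equiv.Perm (ℤ × Fin 2)) : permCLM e * permCLM e.symm = 1 := by
  ext ψ p
  simp [permCLM_apply]

theorem stepCLM_mul_stepInv (Θ : Params) : stepCLM Θ * stepInv Θ = 1 := by
  calc stepCLM Θ * stepInv Θ = permCLM shiftPerm *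
        (coinCLM (coin Θ) * coinCLM (coin Θ).conjTranspose) * permCLM shiftPerm.symm := by
        rw [stepCLM, stepInv]; noncomm_ring
    _ = 1 := by
        rw [← coinCLM_mul, coin_mul_conjTranspose_coin, coinCLM_one, mul_one, permCLM_mul_symm]

theorem stepInv_mul_stepCLM (Θ : Params) : stepInv Θ * stepCLM Θ = 1 := by
  calc stepInv Θ * stepCLM Θ = coinCLM (coin Θ).conjTranspose *
        (permCLM shiftPerm.symm * permCLM shiftPerm.symm.symm) * coinCLM (coin Θ) := by
        rw [stepCLM, stepInv, Equiv.symm_symm]; noncomm_ring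
    _ = 1 := by
        rw [permCLM_mul_symm, mul_one, ← coinCLM_mul, conjTranspose_coin_mul_coin, coinCLM_one]

theorem norm_stepCLM_apply (Θ : Params) (ψ : WalkSpace) : ‖stepCLM Θ ψ‖ = ‖ψ‖ := by
  rw [stepCLM, mul_apply_eq_comp, norm_permCLM_apply,
    norm_coinCLM_apply (conjTranspose_coin_mul_coin Θ)]

theorem norm_stepInv_apply (Θ : Params) (ψ : WalkSpace) : ‖stepInv Θ ψ‖ = ‖ψ‖ := by
  rw [← norm_stepCLM_apply Θ, ← mul_apply_eq_comp, stepCLM_mul_stepInv]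
  rfl

theorem state_eq (Ψ₀ : WalkSpace) (t : ℕ) (Θ : Params) : state Ψ₀ t Θ = (stepCLM Θ ^ t) Ψ₀ := by
  induction t with
  | zero => rfl
  | succ t ih =>
    rw [state, pow_succ', Module.End.mul_apply, pow_succ', mul_apply_eq_comp, ← ih]
    rfl

theorem hasDerivAt_stateAlong (Ψ₀ : WalkSpace) (t : ℕ) (Θ : Params) (μ : CoinParam) :
    HasDerivAt (stateAlong Ψ₀ t Θ μ)
      ((stepCLM Θ ^ t) (conjSum (stepCLM Θ) (stepInv Θ) (coinCLM (coinGen Θ μ)) t Ψ₀)) (Θ μ) := by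
  have h1 : HasDerivAt (fun s => stepCLM (Function.update Θ μ s))
      (stepCLM (Function.update Θ μ (Θ μ)) * coinCLM (coinGen Θ μ)) (Θ μ) := by
    rw [Function.update_eq_self, stepCLM, mul_assoc, ← coinCLM_mul, coin_mul_coinGen]
    exact (hasDerivAt_coinCLM (hasDerivAt_coin Θ μ)).const_mul _
  have h2 := hasDerivAt_pow_conjSum (V := stepInv Θ) h1
    (by rw [Function.update_eq_self, stepCLM_mul_stepInv]) t
  rw [Function.update_eq_self] at h2
  have h3 := ((ContinuousLinearMap.apply ℂ WalkSpace Ψ₀).restrictScalars ℝ).hasFDerivAt.comp_hasDerivAt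
    (Θ μ) h2
  refine h3.congr_of_eventuallyEq (Filter.Eventually.of_forall fun s => ?_)
  exact state_eq Ψ₀ t _

theorem stepCLM_apply_zero (Θ : Params) (ψ : WalkSpace) (x : ℤ) :
    stepCLM Θ ψ (x, 0) = coin Θ 0 0 * ψ (x - 1, 0) + coin Θ 0 1 * ψ (x - 1, 1) := by
  rw [stepCLM, mul_apply_eq_comp, permCLM_apply]
  exact coinCLM_apply _ _ _ _

theorem stepCLM_apply_one (Θ : Params) (ψ : WalkSpace) (x : ℤ) :
    stepCLM Θ ψ (x, 1) = coin Θ 1 0 * ψ (x + 1, 0) + coin Θ 1 1 * ψ (x + 1, 1) := by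
  rw [stepCLM, mul_apply_eq_comp, permCLM_apply]
  exact coinCLM_apply _ _ _ _

theorem stepInv_apply (Θ : Params) (ψ : WalkSpace) (x : ℤ) (j : Fin 2) :
    stepInv Θ ψ (x, j) = (coin Θ).conjTranspose j 0 * ψ (x + 1, 0) +
      (coin Θ).conjTranspose j 1 * ψ (x - 1, 1) := by
  rw [stepInv, mul_apply_eq_comp, coinCLM_apply, permCLM_apply, permCLM_apply]
  rfl

/-- The translation of the lattice. -/
def translation : Equiv.Perm (ℤ × Fin 2) :=
  (Equiv.subRight 1).prodCongr (Equiv.refl _)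

/-- Cayley–Hamilton in each momentum fibre: `det u_k = 1` gives `u_k + u_k⁻¹ = Tr(u_k) 𝟙`, and
`Tr(u_k) = 2 cos θ cos (k - α)` is a combination of the two lattice translations. -/
theorem stepCLM_add_stepInv (Θ : Params) : stepCLM Θ + stepInv Θ =
    (Real.cos (Θ .θ) : ℂ) • (Complex.exp (Complex.I * (Θ .α : ℂ)) • permCLM translation +
      Complex.exp (-(Complex.I * (Θ .α : ℂ))) • permCLM translation.symm) := by
  ext1 ψ
  rw [add_apply, smul_apply, add_apply, smul_apply, smul_apply]
  refine walk_ext (fun x => ?_) fun x => ?_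
  · rw [lp.coeFn_add, Pi.add_apply, stepCLM_apply_zero, stepInv_apply, conjTranspose_coin]
    change _ = (Real.cos (Θ .θ) : ℂ) * (_ * ψ (x - 1, 0) + _ * ψ (x + 1, 0))
    simp only [coin, Matrix.of_apply, Matrix.cons_val', Matrix.cons_val_zero, Matrix.cons_val_one,
      Matrix.cons_val_fin_one]
    ring
  · rw [lp.coeFn_add, Pi.add_apply, stepCLM_apply_one, stepInv_apply, conjTranspose_coin]
    change _ = (Real.cos (Θ .θ) : ℂ) * (_ * ψ (x - 1, 1) + _ * ψ (x + 1, 1))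
    simp only [coin, Matrix.of_apply, Matrix.cons_val', Matrix.cons_val_zero, Matrix.cons_val_one,
      Matrix.cons_val_fin_one]
    ring

theorem commute_stepCLM_add_stepInv (Θ : Params) (C : Matrix (Fin 2) (Fin 2) ℂ) :
    Commute (stepCLM Θ + stepInv Θ) (coinCLM C) := by
  have h1 : Commute (permCLM translation) (coinCLM C) := by
    ext1 ψ
    ext ⟨x, j⟩
    change coinCLM C ψ (x - 1, j) = coinCLM C (permCLM translation ψ) (x, j)
    rw [coinCLM_apply, coinCLM_apply]
    rfl
  have h2 : Commute (permCLM translation.symm) (coinCLM C) := by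
    ext1 ψ
    ext ⟨x, j⟩
    change coinCLM C ψ (x + 1, j) = coinCLM C (permCLM translation.symm ψ) (x, j)
    rw [coinCLM_apply, coinCLM_apply]
    rfl
  rw [stepCLM_add_stepInv]
  exact ((h1.smul_left _).add_left (h2.smul_left _)).smul_left _

theorem norm_stepCLM_add_stepInv_le (Θ : Params) :
    ‖stepCLM Θ + stepInv Θ‖ ≤ 2 * |Real.cos (Θ .θ)| := by
  refine ContinuousLinearMap.opNorm_le_bound _ (by positivity) fun ψ => ?_
  have e1 : ‖Complex.exp (Complex.I * (Θ .α : ℂ))‖ = 1 := by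
    rw [mul_comm]; exact Complex.norm_exp_ofReal_mul_I _
  have e2 : ‖Complex.exp (-(Complex.I * (Θ .α : ℂ)))‖ = 1 := by
    rw [Complex.exp_neg, norm_inv, e1, inv_one]
  rw [stepCLM_add_stepInv, smul_apply, add_apply, smul_apply, smul_apply, norm_smul,
    Complex.norm_real, Real.norm_eq_abs]
  have h := norm_add_le (Complex.exp (Complex.I * (Θ .α : ℂ)) • permCLM translation ψ)
    (Complex.exp (-(Complex.I * (Θ .α : ℂ))) • permCLM translation.symm ψ)
  rw [norm_smul, norm_smul, e1, e2, norm_permCLM_apply, norm_permCLM_apply] at h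
  have := mul_le_mul_of_nonneg_left h (abs_nonneg (Real.cos (Θ .θ)))
  linarith

/-- Neumann series: `B² = -4 (1 - W²/4)` with `‖W²/4‖ ≤ cos² θ < 1`, and an element whose square is
a unit is a unit. -/
theorem isUnit_stepCLM_sub_stepInv {Θ : Params} (hs : Real.sin (Θ .θ) ≠ 0) :
    IsUnit (stepCLM Θ - stepInv Θ) := by
  set W := stepCLM Θ + stepInv Θ with hW
  have hBB : (stepCLM Θ - stepInv Θ) ^ 2 = (-4 : ℂ) • (1 - (1 / 4 : ℂ) • (W * W)) := by
    calc (stepCLM Θ - stepInv Θ) ^ 2 = W * W - 2 • (stepCLM Θ * stepInv Θ) -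
          2 • (stepInv Θ * stepCLM Θ) := by rw [hW]; noncomm_ring
      _ = W * W - (4 : ℂ) • 1 := by
        rw [stepCLM_mul_stepInv, stepInv_mul_stepCLM, sub_sub, ← add_nsmul,
          ← Nat.cast_smul_eq_nsmul ℂ]
        norm_num
      _ = _ := by
        rw [smul_sub, smul_smul, neg_smul]
        norm_num
        abel
  have hn : ‖(1 / 4 : ℂ) • (W * W)‖ < 1 := by
    have h1 : ‖W * W‖ ≤ (2 * |Real.cos (Θ .θ)|) * (2 * |Real.cos (Θ .θ)|) :=
      (norm_mul_le _ _).trans (mul_le_mul (norm_stepCLM_add_stepInv_le Θ)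
        (norm_stepCLM_add_stepInv_le Θ) (norm_nonneg _) (by positivity))
    have h2 := abs_mul_abs_self (Real.cos (Θ .θ))
    have h3 := Real.sin_sq_add_cos_sq (Θ .θ)
    have h4 : 0 < Real.sin (Θ .θ) ^ 2 := by positivity
    rw [norm_smul]
    norm_num
    nlinarith
  have h := (isUnit_one_sub_of_norm_lt_one hn).smul (Units.mk0 (-4 : ℂ) (by norm_num))
  have h' : IsUnit ((stepCLM Θ - stepInv Θ) ^ 2) := by
    rw [hBB]
    exact h
  exact (isUnit_pow_iff two_ne_zero).1 h'

/-! ### The Fisher matrix as a form in generator sums, and the entries involving `β`. -/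

/-- The sum of the conjugates of the generator `C† ∂_μ C`, applied to the initial state. -/
def genSum (Ψ₀ : WalkSpace) (t : ℕ) (Θ : Params) (μ : CoinParam) : WalkSpace :=
  conjSum (stepCLM Θ) (stepInv Θ) (coinCLM (coinGen Θ μ)) t Ψ₀

theorem qfi_eq (Ψ₀ : WalkSpace) (t : ℕ) (Θ : Params) (μ ν : CoinParam) :
    qfi Ψ₀ t Θ μ ν = fisherForm Ψ₀ (genSum Ψ₀ t Θ μ) (genSum Ψ₀ t Θ ν) := by
  have h : ∀ μ, dstate Ψ₀ t Θ μ = (stepCLM Θ ^ t) (genSum Ψ₀ t Θ μ) := fun μ =>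
    (hasDerivAt_stateAlong Ψ₀ t Θ μ).deriv
  rw [qfi, h, h, state_eq]
  exact fisherForm_map (norm_pow_apply (norm_stepCLM_apply Θ) t) _ _ _

theorem qfi_div_sq (Ψ₀ : WalkSpace) (t : ℕ) (Θ : Params) (μ ν : CoinParam) :
    qfi Ψ₀ t Θ μ ν / (t : ℝ) ^ 2 = fisherForm Ψ₀ ((t : ℂ)⁻¹ • genSum Ψ₀ t Θ μ)
      ((t : ℂ)⁻¹ • genSum Ψ₀ t Θ ν) := by
  have h := fisherForm_smul Ψ₀ (genSum Ψ₀ t Θ μ) (genSum Ψ₀ t Θ ν) ((t : ℝ)⁻¹)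
  push_cast at h
  rw [h, qfi_eq, inv_pow, div_eq_inv_mul]

/-- Infinitesimal form of the conjugation by `diag(e^{iβ/2}, e^{-iβ/2})`: `∂_β C = Z C - C Z`,
multiplied on the left by `C†`. -/
theorem conjTranspose_coin_mul_diagonal_mul_coin (Θ : Params) :
    (coin Θ).conjTranspose * (!![Complex.I / 2, 0; 0, -(Complex.I / 2)] * coin Θ) =
      coinGen Θ .β + !![Complex.I / 2, 0; 0, -(Complex.I / 2)] := by
  rw [conjTranspose_coin, coin, coinGen]
  have ha := exp_mul_exp_neg (Complex.I * (Θ .α : ℂ))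
  have hb := exp_mul_exp_neg (Complex.I * (Θ .β : ℂ))
  have hs := ofReal_sin_sq_add_cos_sq (Θ .θ)
  generalize Complex.exp (Complex.I * (Θ .α : ℂ)) = a at *
  generalize Complex.exp (-(Complex.I * (Θ .α : ℂ))) = a' at *
  generalize Complex.exp (Complex.I * (Θ .β : ℂ)) = b at *
  generalize Complex.exp (-(Complex.I * (Θ .β : ℂ))) = b' at *
  generalize ((Real.sin (Θ .θ) : ℝ) : ℂ) = s at *
  generalize ((Real.cos (Θ .θ) : ℝ) : ℂ) = c at *
  ext i j
  fin_cases i <;> fin_cases j <;> simp [Matrix.mul_apply, Fin.sum_univ_two]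
  · linear_combination Complex.I / 2 * (hs + c ^ 2 * ha - s ^ 2 * hb)
  · ring
  · ring
  · linear_combination -Complex.I / 2 * (hs + c ^ 2 * ha - s ^ 2 * hb)

theorem coinCLM_coinGen_beta (Θ : Params) : coinCLM (coinGen Θ .β) =
    0 + (stepInv Θ * coinCLM !![Complex.I / 2, 0; 0, -(Complex.I / 2)] * stepCLM Θ -
      coinCLM !![Complex.I / 2, 0; 0, -(Complex.I / 2)]) := by
  set Z : Matrix (Fin 2) (Fin 2) ℂ := !![Complex.I / 2, 0; 0, -(Complex.I / 2)] with hZ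
  -- `Z` is diagonal and the shift preserves the coin state, so they commute; this lifts the coin
  -- identity to the whole step.
  have hc : coinCLM Z * permCLM shiftPerm = permCLM shiftPerm * coinCLM Z := by
    ext1 ψ
    refine walk_ext (fun x => ?_) fun x => ?_
    · rw [mul_apply_eq_comp, mul_apply_eq_comp, permCLM_apply, coinCLM_apply]
      change _ = coinCLM Z ψ (x - 1, 0)
      rw [coinCLM_apply]
      simp [hZ, permCLM_apply, shiftPerm]
    · rw [mul_apply_eq_comp, mul_apply_eq_comp, permCLM_apply, coinCLM_apply]
      change _ = coinCLM Z ψ (x + 1, 1)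
      rw [coinCLM_apply]
      simp [hZ, permCLM_apply, shiftPerm]
  have h : stepInv Θ * coinCLM Z * stepCLM Θ = coinCLM (coinGen Θ .β + Z) := by
    calc stepInv Θ * coinCLM Z * stepCLM Θ
        = coinCLM (coin Θ).conjTranspose * permCLM shiftPerm.symm *
            (coinCLM Z * permCLM shiftPerm) * coinCLM (coin Θ) := by
          rw [stepInv, stepCLM]; noncomm_ring
      _ = coinCLM (coin Θ).conjTranspose * (permCLM shiftPerm.symm * permCLM shiftPerm.symm.symm) *
            (coinCLM Z * coinCLM (coin Θ)) := by
          rw [hc, Equiv.symm_symm]; noncomm_ring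
      _ = _ := by
          rw [permCLM_mul_symm, mul_one, ← coinCLM_mul, ← coinCLM_mul,
            conjTranspose_coin_mul_diagonal_mul_coin]
  rw [h, coinCLM_add, zero_add, add_sub_cancel_right]

theorem tendsto_genSum_beta (Ψ₀ : WalkSpace) (Θ : Params) :
    Filter.Tendsto (fun t : ℕ => (t : ℂ)⁻¹ • genSum Ψ₀ t Θ .β) Filter.atTop (nhds 0) :=
  tendsto_conjSum (norm_stepCLM_apply Θ) (norm_stepInv_apply Θ) (stepInv_mul_stepCLM Θ)
    (Commute.zero_left _) (coinCLM_coinGen_beta Θ) Ψ₀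

theorem tendsto_qfi_beta {Ψ₀ : WalkSpace} (h0 : ‖Ψ₀‖ = 1) (Θ : Params) (μ : CoinParam) :
    Filter.Tendsto (fun t : ℕ => qfi Ψ₀ t Θ μ .β / (t : ℝ) ^ 2) Filter.atTop (nhds 0) := by
  have h1 := ((tendsto_genSum_beta Ψ₀ Θ).norm.const_mul (8 * ‖coinCLM (coinGen Θ μ)‖))
  rw [norm_zero, mul_zero] at h1
  refine squeeze_zero_norm (fun t => ?_) h1
  rw [qfi_div_sq, Real.norm_eq_abs]
  refine (abs_fisherForm_le h0 _ _).trans ?_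
  rw [mul_assoc]
  refine mul_le_mul_of_nonneg_left (mul_le_mul_of_nonneg_right ?_ (norm_nonneg _)) (by norm_num)
  have h2 := norm_conjSum_le (norm_stepCLM_apply Θ) (norm_stepInv_apply Θ)
    (coinCLM (coinGen Θ μ)) t Ψ₀
  rw [h0, mul_one] at h2
  rw [norm_smul, norm_inv, Complex.norm_natCast]
  refine (mul_le_mul_of_nonneg_left h2 (by positivity)).trans ?_
  -- At `t = 0` the convention `0⁻¹ = 0` makes the left side zero.
  rcases Nat.eq_zero_or_pos t with rfl | ht
  · simp
  · have : (t : ℝ) ≠ 0 := by exact_mod_cast ht.ne'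
    rw [← mul_assoc, inv_mul_cancel₀ this, one_mul]

/-! ### Nondegeneracy of the `θ`-`α` block for a localized walker. -/

/-- The state `|0⟩ ⊗ |0⟩`. -/
def localizedState : WalkSpace := lp.single 2 ((0 : ℤ), (0 : Fin 2)) (1 : ℂ)

theorem norm_localizedState : ‖localizedState‖ = 1 := by
  rw [localizedState, lp.norm_single (by norm_num), norm_one]

theorem localizedState_apply (x : ℤ) (j : Fin 2) :
    localizedState (x, j) = if x = 0 ∧ j = 0 then 1 else 0 := by
  rw [localizedState, lp.single_apply]
  by_cases h : x = 0 ∧ j = 0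
  · obtain ⟨rfl, rfl⟩ := h
    simp
  · rw [if_neg h, Pi.single_eq_of_ne]
    simpa [Prod.ext_iff] using h

/-- The only real combination of the generators of `θ` and `α` whose time average has
`localizedState` as an eigenvector is zero. -/
theorem eq_zero_of_anticommutator_eq {Θ : Params} (hs : Real.sin (Θ .θ) ≠ 0)
    (hc : Real.cos (Θ .θ) ≠ 0) {x y : ℝ} {l : ℂ}
    (h : ((stepCLM Θ - stepInv Θ) * coinCLM ((x : ℂ) • coinGen Θ .θ + (y : ℂ) • coinGen Θ .α) +
      coinCLM ((x : ℂ) • coinGen Θ .θ + (y : ℂ) • coinGen Θ .α) * (stepCLM Θ - stepInv Θ))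
        localizedState = (l • (stepCLM Θ - stepInv Θ)) localizedState) : x = 0 ∧ y = 0 := by
  -- At `(-1, 1)` the anticommutator side vanishes while the right side is a nonzero multiple of `l
  -- sin θ`, forcing `l = 0`. The amplitude at `(1, 0)` then gives `x sin θ = i y cos θ`, whose real
  -- and imaginary parts separate `x` and `y`.
  have h1 := congrArg (fun ψ : WalkSpace => ψ (-1, 1)) h
  have h2 := congrArg (fun ψ : WalkSpace => ψ (1, 0)) h
  simp only [add_apply, sub_apply, smul_apply, mul_apply_eq_comp, lp.coeFn_add, Pi.add_apply,
    lp.coeFn_sub, Pi.sub_apply, lp.coeFn_smul, Pi.smul_apply, stepCLM_apply_zero,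
    stepCLM_apply_one, stepInv_apply, coinCLM_apply, localizedState_apply, smul_eq_mul,
    conjTranspose_coin] at h1 h2
  have ha := exp_mul_exp_neg (Complex.I * (Θ .α : ℂ))
  have hb := exp_mul_exp_neg (Complex.I * (Θ .β : ℂ))
  have hsc := ofReal_sin_sq_add_cos_sq (Θ .θ)
  have hs' : ((Real.sin (Θ .θ) : ℝ) : ℂ) ≠ 0 := by exact_mod_cast hs
  have key : ((Real.sin (Θ .θ) * x : ℝ) : ℂ) = Complex.I * ((Real.cos (Θ .θ) * y : ℝ) : ℂ) := by
    rw [Complex.ofReal_mul, Complex.ofReal_mul]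
    norm_num [coin, coinGen, -Complex.ofReal_cos, -Complex.ofReal_sin] at h1 h2
    generalize Complex.exp (Complex.I * (Θ .α : ℂ)) = a at *
    generalize Complex.exp (-(Complex.I * (Θ .α : ℂ))) = a' at *
    generalize Complex.exp (Complex.I * (Θ .β : ℂ)) = b at *
    generalize Complex.exp (-(Complex.I * (Θ .β : ℂ))) = b' at *
    generalize ((Real.sin (Θ .θ) : ℝ) : ℂ) = s at *
    generalize ((Real.cos (Θ .θ) : ℝ) : ℂ) = c at *
    have hl : l * (b' * s) = 0 := by linear_combination (1 / 2) * h1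
    have hl0 : l = 0 :=
      (mul_eq_zero.1 hl).resolve_right (mul_ne_zero (right_ne_zero_of_mul_eq_one hb) hs')
    subst hl0
    refine mul_left_cancel₀ (left_ne_zero_of_mul_eq_one ha) ?_
    linear_combination (-1 / 2) * h2 + a * (Complex.I * y * c * s ^ 2 - s * x) * hb +
      a * Complex.I * c * y * hsc
  have hre := congrArg Complex.re key
  have him := congrArg Complex.im key
  simp only [Complex.ofReal_re, Complex.ofReal_im, Complex.mul_re, Complex.mul_im, Complex.I_re,
    Complex.I_im] at hre him
  refine ⟨?_, ?_⟩
  · exact (mul_eq_zero.1 (hre.trans (by ring))).resolve_left hs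
  · exact (mul_eq_zero.1 (show Real.cos (Θ .θ) * y = 0 by linarith)).resolve_left hc

/-- The time average of the generator of `μ`, where `B'` is the inverse of `U - U⁻¹`. -/
def averagedGen (Θ : Params) (B' : WalkSpace →L[ℂ] WalkSpace) (μ : CoinParam) :
    WalkSpace →L[ℂ] WalkSpace :=
  (1 / 2 : ℂ) • (coinCLM (coinGen Θ μ) + B' * coinCLM (coinGen Θ μ) * (stepCLM Θ - stepInv Θ))

/-- Multiplying by `U - U⁻¹` removes the nonlocal inverse `B'`; what remains moves the walker by at
most one site, so its amplitudes can be computed explicitly. -/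
theorem sub_mul_averagedGen {Θ : Params} {B' : WalkSpace →L[ℂ] WalkSpace}
    (hB : (stepCLM Θ - stepInv Θ) * B' = 1) (x y : ℂ) :
    (stepCLM Θ - stepInv Θ) * (x • averagedGen Θ B' .θ + y • averagedGen Θ B' .α) =
      (1 / 2 : ℂ) • ((stepCLM Θ - stepInv Θ) * coinCLM (x • coinGen Θ .θ + y • coinGen Θ .α) +
      coinCLM (x • coinGen Θ .θ + y • coinGen Θ .α) * (stepCLM Θ - stepInv Θ)) := by
  set B := stepCLM Θ - stepInv Θ
  have h : ∀ μ, B * averagedGen Θ B' μ =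
      (1 / 2 : ℂ) • (B * coinCLM (coinGen Θ μ) + coinCLM (coinGen Θ μ) * B) := by
    intro μ
    rw [averagedGen, mul_smul_comm, mul_add, ← mul_assoc, ← mul_assoc, hB, one_mul]
  rw [mul_add, mul_smul_comm, mul_smul_comm, h, h, coinCLM_add, coinCLM_smul, coinCLM_smul,
    smul_comm x, smul_comm y, ← smul_add, mul_add, add_mul, mul_smul_comm, mul_smul_comm,
    smul_mul_assoc, smul_mul_assoc]
  simp only [smul_add]
  abel

/-- The `θ`-`α` block of the quantum Fisher information matrix for the localized initial state. -/
theorem exists_posDef_limit_qfi {Θ : Params} (hs : Real.sin (Θ .θ) ≠ 0)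
    (hc : Real.cos (Θ .θ) ≠ 0) :
    ∃ G : Matrix (Fin 2) (Fin 2) ℝ, G.PosDef ∧
      Filter.Tendsto
        (fun t : ℕ => (1 / (t : ℝ) ^ 2) •
          !![qfi localizedState t Θ .θ .θ, qfi localizedState t Θ .θ .α;
            qfi localizedState t Θ .α .θ, qfi localizedState t Θ .α .α])
        Filter.atTop (nhds G) := by
  obtain ⟨⟨B, B', hB, hB'⟩, hBU⟩ := isUnit_stepCLM_sub_stepInv hs
  change B = _ at hBU
  subst hBU
  have hlim : ∀ μ, Filter.Tendsto (fun t : ℕ => (t : ℂ)⁻¹ • genSum localizedState t Θ μ)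
      Filter.atTop (nhds (averagedGen Θ B' μ localizedState)) := by
    intro μ
    obtain ⟨h1, Y, h2⟩ := exists_coboundary (stepCLM_mul_stepInv Θ) (stepInv_mul_stepCLM Θ)
      (commute_stepCLM_add_stepInv Θ (coinGen Θ μ)) hB hB'
    exact tendsto_conjSum (norm_stepCLM_apply Θ) (norm_stepInv_apply Θ) (stepInv_mul_stepCLM Θ)
      h1 h2 _
  have hq : ∀ μ ν, Filter.Tendsto
      (fun t : ℕ => 1 / (t : ℝ) ^ 2 * qfi localizedState t Θ μ ν) Filter.atTop
      (nhds (fisherForm localizedState (averagedGen Θ B' μ localizedState)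
        (averagedGen Θ B' ν localizedState))) := by
    intro μ ν
    refine (((continuous_fisherForm localizedState).tendsto (_, _)).comp
      ((hlim μ).prodMk_nhds (hlim ν))).congr fun t => ?_
    rw [one_div_mul_eq_div, qfi_div_sq]
    rfl
  refine ⟨_, posDef_fisherForm (v := averagedGen Θ B' .θ localizedState)
    (w := averagedGen Θ B' .α localizedState) norm_localizedState fun x y l h => ?_, ?_⟩
  -- The factor 2 clears the `1 / 2` in the averaged generators.
  · refine eq_zero_of_anticommutator_eq hs hc (l := 2 * l) ?_
    have h1 := congrArg (stepCLM Θ - stepInv Θ) h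
    have h2 := congrArg (fun T : WalkSpace →L[ℂ] WalkSpace => (2 : ℂ) • T localizedState)
      (sub_mul_averagedGen hB (x : ℂ) (y : ℂ))
    simp only [mul_apply_eq_comp, add_apply, smul_apply] at h2
    rw [h1, map_smul, smul_smul, smul_smul, show (2 : ℂ) * (1 / 2) = 1 by norm_num, one_smul] at h2
    simp only [mul_apply_eq_comp, add_apply, smul_apply]
    exact h2.symm
  · refine tendsto_pi_nhds.2 fun i => tendsto_pi_nhds.2 fun j => ?_
    fin_cases i <;> fin_cases j
    · exact hq .θ .θ
    · exact hq .θ .α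
    · exact hq .α .θ
    · exact hq .α .α

/-! The momentum-space statements. -/

theorem stepK_conjTranspose_mul_diag (k : ℝ) :
    (!![Complex.exp (-(Complex.I * (k : ℂ))), 0; 0, Complex.exp (Complex.I * (k : ℂ))] :
      Matrix (Fin 2) (Fin 2) ℂ).conjTranspose *
    !![Complex.exp (-(Complex.I * (k : ℂ))), 0; 0, Complex.exp (Complex.I * (k : ℂ))] = 1 := by
  have h := exp_mul_exp_neg (Complex.I * (k : ℂ))
  ext i j
  fin_cases i <;> fin_cases j <;>
    simp [Matrix.mul_apply, Fin.sum_univ_two, Matrix.conjTranspose_apply]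
  · rw [starRingEnd_apply, star_exp_neg_I_mul, h]
  · rw [starRingEnd_apply, star_exp_I_mul, mul_comm, h]

/-- The phase matrix `diag(e^{-ik}, e^{ik})` is unitary and independent of `Θ`, so it cancels from
`u_k† ∂_μ u_k`. -/
theorem genO_eq_coinGen (k : ℝ) (Θ : Params) (μ : CoinParam) : genO k Θ μ = coinGen Θ μ := by
  set D : Matrix (Fin 2) (Fin 2) ℂ :=
    !![Complex.exp (-(Complex.I * (k : ℂ))), 0; 0, Complex.exp (Complex.I * (k : ℂ))] with hD
  have h : dstepK k Θ μ = D * coinDeriv Θ μ := by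
    ext i j
    refine HasDerivAt.deriv ?_
    simp only [stepK, Matrix.mul_apply]
    exact HasDerivAt.fun_sum fun l _ => (hasDerivAt_coin Θ μ l j).const_mul (D i l)
  rw [genO, h, stepK, ← hD, ← coin_mul_coinGen, Matrix.conjTranspose_mul]
  calc (coin Θ).conjTranspose * D.conjTranspose * (D * (coin Θ * coinGen Θ μ))
      = (coin Θ).conjTranspose * (D.conjTranspose * D) * coin Θ * coinGen Θ μ := by
        noncomm_ring
    _ = coinGen Θ μ := by
        rw [stepK_conjTranspose_mul_diag, mul_one, conjTranspose_coin_mul_coin, one_mul]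

theorem exp_I_mul_eq (x : ℝ) :
    Complex.exp (Complex.I * (x : ℂ)) = (Real.cos x : ℂ) + (Real.sin x : ℂ) * Complex.I := by
  rw [mul_comm, Complex.exp_mul_I, Complex.ofReal_cos, Complex.ofReal_sin]

theorem exp_neg_I_mul_eq (x : ℝ) :
    Complex.exp (-(Complex.I * (x : ℂ))) = (Real.cos x : ℂ) - (Real.sin x : ℂ) * Complex.I := by
  rw [← star_exp_I_mul, exp_I_mul_eq]
  simp [-Complex.ofReal_cos, -Complex.ofReal_sin, sub_eq_add_neg]

theorem blochVec_coinGen_beta (Θ : Params) : blochVec (coinGen Θ .β) =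
    ![0, 2 * Complex.I * ((Real.sin (Θ .θ) * Real.cos (Θ .θ) * Real.cos (Θ .β - Θ .α) : ℝ) : ℂ),
      -2 * Complex.I * ((Real.sin (Θ .θ) * Real.cos (Θ .θ) * Real.sin (Θ .β - Θ .α) : ℝ) : ℂ),
      -2 * Complex.I * ((Real.sin (Θ .θ) ^ 2 : ℝ) : ℂ)] := by
  rw [Real.cos_sub, Real.sin_sub]
  ext i
  fin_cases i <;>
    simp [blochVec, pauli, coinGen, Matrix.trace, Fin.sum_univ_two,
      -Complex.ofReal_cos, -Complex.ofReal_sin, exp_I_mul_eq, exp_neg_I_mul_eq]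
  · ring_nf
    simp only [Complex.I_pow_three]
    ring
  · ring_nf
    simp only [Complex.I_pow_three]
    ring
  · ring

theorem projA_mulVec_blochVec_beta (Θ : Params) (k : ℝ) :
    (projA k Θ).mulVec (blochVec (genO k Θ .β)) = 0 := by
  -- Up to the factor `2i` this is the product of `m` with the Pauli components of `O_β`; it
  -- vanishes by the addition formula for `k - α = (k - β) + (β - α)`. The lower block of `A_k^𝟙` is
  -- `N m mᵀ`, so each of its rows is a multiple of this identity.
  have key : Real.sin (k - Θ .β) * (Real.sin (Θ .θ) * Real.cos (Θ .θ) * Real.cos (Θ .β - Θ .α)) +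
      Real.cos (k - Θ .β) * (Real.sin (Θ .θ) * Real.cos (Θ .θ) * Real.sin (Θ .β - Θ .α)) -
      Real.cot (Θ .θ) * Real.sin (k - Θ .α) * Real.sin (Θ .θ) ^ 2 = 0 := by
    have h : k - Θ .α = (k - Θ .β) + (Θ .β - Θ .α) := by ring
    rw [h, Real.sin_add, Real.cot_eq_cos_div_sin]
    field_simp
    ring
  rw [genO_eq_coinGen, blochVec_coinGen_beta]
  have keyC := congrArg (fun r : ℝ => (r : ℂ)) key
  simp only [Complex.ofReal_sub, Complex.ofReal_add, Complex.ofReal_mul, Complex.ofReal_zero,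
    Complex.ofReal_pow] at keyC
  ext i
  fin_cases i <;>
    simp [projA, projAReal, Matrix.mulVec, dotProduct, Fin.sum_univ_four,
      -Complex.ofReal_cos, -Complex.ofReal_sin, -Complex.ofReal_cot]
  · linear_combination 2 * Complex.I * (normN k Θ : ℂ) * (Real.sin (k - Θ .β) : ℂ) * keyC
  · linear_combination -2 * Complex.I * (normN k Θ : ℂ) * (Real.cos (k - Θ .β) : ℂ) * keyC
  · linear_combination 2 * Complex.I * (normN k Θ : ℂ) * (Real.cot (Θ .θ) : ℂ) *
      (Real.sin (k - Θ .α) : ℂ) * keyC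

/-- Hermiticity carries the annihilation of `|O_β))` over to `((O_β|`, covering the entries with `β`
as first index. -/
theorem conjTranspose_projA (k : ℝ) (Θ : Params) : (projA k Θ).conjTranspose = projA k Θ := by
  have h : ∀ i j, projAReal k Θ j i = projAReal k Θ i j := by
    intro i j
    fin_cases i <;> fin_cases j <;> simp [projAReal]
  ext i j
  rw [Matrix.conjTranspose_apply, projA, Matrix.map_apply, Matrix.map_apply, h i j]
  exact star_ofReal _

theorem sandwich_eq_zero_right {k : ℝ} {Θ : Params} {w : Fin 4 → ℂ}
    (hw : (projA k Θ).mulVec w = 0) (v : Fin 4 → ℂ) : sandwich k Θ v w = 0 := by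
  rw [sandwich, hw, dotProduct_zero]

theorem sandwich_eq_zero_left {k : ℝ} {Θ : Params} {w : Fin 4 → ℂ}
    (hw : (projA k Θ).mulVec w = 0) (v : Fin 4 → ℂ) : sandwich k Θ w v = 0 := by
  rw [sandwich, Matrix.dotProduct_mulVec, ← conjTranspose_projA, ← Matrix.star_mulVec, hw,
    star_zero, zero_dotProduct]

theorem qfiAsymp_beta (φ : ℝ → EuclideanSpace ℂ (Fin 2)) (t : ℕ) (Θ : Params)
    (μ : CoinParam) :
    qfiAsymp φ t Θ μ .β = 0 ∧ qfiAsymp φ t Θ .β μ = 0 := by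
  have hr := fun k v => sandwich_eq_zero_right (projA_mulVec_blochVec_beta Θ k) v
  have hl := fun k v => sandwich_eq_zero_left (projA_mulVec_blochVec_beta Θ k) v
  constructor
  · simp [qfiAsymp, hr]
  · simp [qfiAsymp, hl]

end

end QWalk

open QWalk
theorem corollary1 :
    -- `A_k^𝟙` annihilates the Bloch vector of `O_β`
    (∀ Θ : Params, Real.sin (Θ .θ) ≠ 0 → ∀ k : ℝ,
      (projA k Θ).mulVec (blochVec (genO k Θ .β)) = 0) ∧
    -- every element involving `β` of the asymptotic expression for the QFI matrix vanishes
    (∀ Θ : Params, Real.sin (Θ .θ) ≠ 0 →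
      ∀ (Ψ₀ : WalkSpace) (φ : ℝ → EuclideanSpace ℂ (Fin 2)),
        ‖Ψ₀‖ = 1 → IsMomentumAmplitude Ψ₀ φ →
        ∀ (t : ℕ) (μ : CoinParam), qfiAsymp φ t Θ μ .β = 0 ∧ qfiAsymp φ t Θ .β μ = 0) ∧
    -- for every initial state, the elements involving `β` of the QFI matrix of the walk
    -- vanish at order `t²`
    (∀ (Θ : Params) (Ψ₀ : WalkSpace), ‖Ψ₀‖ = 1 →
      (∀ (t : ℕ) (μ : CoinParam), DifferentiableAt ℝ (stateAlong Ψ₀ t Θ μ) (Θ μ)) ∧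
      ∀ μ : CoinParam,
        Filter.Tendsto (fun t : ℕ => qfi Ψ₀ t Θ μ .β / (t : ℝ) ^ 2) Filter.atTop (nhds 0) ∧
        Filter.Tendsto (fun t : ℕ => qfi Ψ₀ t Θ .β μ / (t : ℝ) ^ 2) Filter.atTop (nhds 0)) ∧
    -- `θ` and `α` can be estimated: for a suitable initial state, their block of the QFI matrix
    -- is nondegenerate at order `t²`
    (∃ Ψ₀ : WalkSpace, ‖Ψ₀‖ = 1 ∧
      ∀ Θ : Params, Real.sin (Θ .θ) ≠ 0 → Real.cos (Θ .θ) ≠ 0 →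
        ∃ G : Matrix (Fin 2) (Fin 2) ℝ, G.PosDef ∧
          Filter.Tendsto
            (fun t : ℕ => (1 / (t : ℝ) ^ 2) •
              !![qfi Ψ₀ t Θ .θ .θ, qfi Ψ₀ t Θ .θ .α; qfi Ψ₀ t Θ .α .θ, qfi Ψ₀ t Θ .α .α])
            Filter.atTop (nhds G)) := by
  refine ⟨fun Θ _ k => projA_mulVec_blochVec_beta Θ k, fun Θ _ Ψ₀ φ _ _ t μ => qfiAsymp_beta φ t Θ μ,
    fun Θ Ψ₀ h0 => ⟨fun t μ => (hasDerivAt_stateAlong Ψ₀ t Θ μ).differentiableAt, fun μ =>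
      ⟨tendsto_qfi_beta h0 Θ μ, ?_⟩⟩,
    ⟨localizedState, norm_localizedState, fun Θ hs hc => exists_posDef_limit_qfi hs hc⟩⟩
  refine (tendsto_qfi_beta h0 Θ μ).congr fun t => ?_
  rw [qfi_eq, qfi_eq, fisherForm_comm]
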